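/- Let $X$ be a non-empty topological space, $E$ a real Hausdorff topological vector space and $\Lambda\subseteq E$ a convex set. Let $f:X\times\Lambda\to\mathbb{R}$ be such that, for each $\lambda\in\Lambda$, the function $f(\cdot,\lambda)$ is lower semicontinuous and inf-compact (that is, for each $r\in\mathbb{R}$ the set $\{x\in X: f(x,\lambda)\le r\}$ is compact) and, for each $x\in X$, the function $f(x,\cdot)$ is upper semicontinuous and concave in $\Lambda$. Assume that $$\sup_{\lambda\in\Lambda}\inf_{x\in X}f(x,\lambda)<\inf_{x\in X}\sup_{\lambda\in\Lambda}f(x,\lambda),$$ where suprema and infima are taken in $[-\infty,+\infty]$. Then there exists $\lambda^*\in\Lambda$ such that the function $f(\cdot,\lambda^*)$ has at least two global minima, that is, there are two distinct points of $X$ at each of which $f(\cdot,\lambda^*)$ attains its minimum over $X$. -/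

import Mathlib

/-- A real-valued function on a topological space is inf-compact if all of its sublevel sets
`{x | ψ x ≤ r}`, with `r` real, are compact. -/
def InfCompact {U : Type*} [TopologicalSpace U] (ψ : U → ℝ) : Prop :=
  ∀ r : ℝ, IsCompact {x : U | ψ x ≤ r}

/-- The point `x` is a global minimum (point) of `ψ`. -/
def IsGlobalMin {U : Type*} (ψ : U → ℝ) (x : U) : Prop :=
  ∀ y : U, ψ x ≤ ψ y

/-!
Suppose all minima are unique. By compactness, finitely many parameters `S` already push every point
of `X` above a level `c` strictly between the two values. On the compact convex set `convexHull ℝ S`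
the upper semicontinuous value function `l ↦ ⨅ x, f x l` attains its maximum, at `k` say. For `l` in
the hull, concavity and the maximality of `k` show that `(1 - t) * f x k + t * f x l` takes a value
at most `⨅ x, f x k` for every `t ∈ (0, 1)`; as `t → 0` this produces a minimum point of `f (·) k`
at which `f (·) l` is at most `⨅ x, f x k`. This minimum point is unique, hence the same for all
`l`: it forms a saddle point with `k`, which contradicts the choice of `S` and `c`.
-/

section GlobalMin

variable {X : Type*} {ψ : X → ℝ}

theorem IsGlobalMin.bddBelow_range {x : X} (hx : IsGlobalMin ψ x) : BddBelow (Set.range ψ) :=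
  ⟨ψ x, Set.forall_mem_range.2 hx⟩

variable [TopologicalSpace X]

theorem InfCompact.exists_isGlobalMin [Nonempty X] (hc : InfCompact ψ)
    (hψ : LowerSemicontinuous ψ) : ∃ x, IsGlobalMin ψ x := by
  let x₀ := Classical.arbitrary X
  obtain ⟨x, hx, hmin⟩ := (hψ.lowerSemicontinuousOn {x | ψ x ≤ ψ x₀}).exists_isMinOn
    ⟨x₀, le_refl (ψ x₀)⟩ (hc (ψ x₀))
  exact ⟨x, fun y => (le_total (ψ y) (ψ x₀)).elim (fun hy => hmin hy) (le_trans hx)⟩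

end GlobalMin

theorem exists_isGlobalMin_le_of_forall_segment_le {X : Type*} [TopologicalSpace X] {p q : X → ℝ}
    {m : ℝ} (hp : LowerSemicontinuous p) (hq : InfCompact q) (hpm : ∀ x, m ≤ p x)
    (hqb : BddBelow (Set.range q))
    (h : ∀ t ∈ Set.Ioo (0 : ℝ) 1, ∃ x, (1 - t) * p x + t * q x ≤ m) :
    ∃ y, IsGlobalMin p y ∧ q y ≤ m := by
  obtain ⟨b, hb⟩ := hqb
  have near_min : ∀ t ∈ Set.Ioo (0 : ℝ) 1, ∃ x, q x ≤ m ∧ (1 - t) * p x ≤ m - t * b := by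
    intro t ht
    obtain ⟨x, hx⟩ := h t ht
    have hpx : (1 - t) * m ≤ (1 - t) * p x :=
      mul_le_mul_of_nonneg_left (hpm x) (sub_nonneg.2 ht.2.le)
    have hqx : t * b ≤ t * q x := mul_le_mul_of_nonneg_left (hb ⟨x, rfl⟩) ht.1.le
    exact ⟨x, le_of_mul_le_mul_left (by linarith) ht.1, by linarith⟩
  obtain ⟨x₁, hx₁, -⟩ := near_min (1 / 2) (by norm_num)
  obtain ⟨y, hy, hmin⟩ := (hp.lowerSemicontinuousOn {x | q x ≤ m}).exists_isMinOn ⟨x₁, hx₁⟩ (hq m)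
  have hbound : ∀ t ∈ Set.Ioo (0 : ℝ) 1, (1 - t) * p y ≤ m - t * b := by
    intro t ht
    obtain ⟨x, hx, hpx⟩ := near_min t ht
    exact (mul_le_mul_of_nonneg_left (hmin hx) (sub_nonneg.2 ht.2.le)).trans hpx
  have hpy : p y ≤ m := by
    have hzero : (0 : ℝ) ∈ closure (Set.Ioo (0 : ℝ) 1) := by
      simp only [closure_Ioo zero_ne_one, Set.left_mem_Icc, zero_le_one]
    simpa only [sub_zero, one_mul, zero_mul] using
      ContinuousWithinAt.closure_le (f := fun t : ℝ => (1 - t) * p y) (g := fun t => m - t * b)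
        hzero (by fun_prop) (by fun_prop) hbound
  exact ⟨y, fun z => hpy.trans (hpm z), hy⟩

section SaddlePoint

variable {X E : Type*} [TopologicalSpace X] [Nonempty X] [AddCommGroup E] [Module ℝ E]
  {K : Set E} {f : X → E → ℝ}

theorem exists_isGlobalMin_le_iInf_of_isMaxOn_iInf
    (hlsc : ∀ l ∈ K, LowerSemicontinuous (fun x => f x l))
    (hinf : ∀ l ∈ K, InfCompact (fun x => f x l)) (hconc : ∀ x, ConcaveOn ℝ K (f x))
    {k l : E} (hk : k ∈ K) (hl : l ∈ K) (hmax : IsMaxOn (fun l => ⨅ x, f x l) K k) :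
    ∃ y, IsGlobalMin (fun x => f x k) y ∧ f y l ≤ ⨅ x, f x k := by
  have exists_min : ∀ l ∈ K, ∃ x, IsGlobalMin (fun x => f x l) x := fun l hl =>
    (hinf l hl).exists_isGlobalMin (hlsc l hl)
  obtain ⟨x, hx⟩ := exists_min k hk
  obtain ⟨w, hw⟩ := exists_min l hl
  refine exists_isGlobalMin_le_of_forall_segment_le (hlsc k hk) (hinf l hl)
    (ciInf_le hx.bddBelow_range) hw.bddBelow_range fun t ht => ?_
  have hnonneg : 0 ≤ 1 - t := sub_nonneg.2 ht.2.le
  have hsum : 1 - t + t = 1 := sub_add_cancel 1 t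
  have hmem : (1 - t) • k + t • l ∈ K := (hconc x).1 hk hl hnonneg ht.1.le hsum
  obtain ⟨v, hv⟩ := exists_min _ hmem
  refine ⟨v, ?_⟩
  calc (1 - t) * f v k + t * f v l
      ≤ f v ((1 - t) • k + t • l) := (hconc v).2 hk hl hnonneg ht.1.le hsum
    _ ≤ ⨅ u, f u ((1 - t) • k + t • l) := le_ciInf hv
    _ ≤ ⨅ u, f u k := hmax hmem

theorem exists_isSaddlePointOn_of_subsingleton_isGlobalMin [TopologicalSpace E]
    (hK : IsCompact K) (hne : K.Nonempty)
    (hlsc : ∀ l ∈ K, LowerSemicontinuous (fun x => f x l))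
    (hinf : ∀ l ∈ K, InfCompact (fun x => f x l))
    (husc : ∀ x, UpperSemicontinuousOn (f x) K) (hconc : ∀ x, ConcaveOn ℝ K (f x))
    (huniq : ∀ l ∈ K, {x | IsGlobalMin (fun x => f x l) x}.Subsingleton) :
    ∃ x, ∃ k ∈ K, IsSaddlePointOn Set.univ K f x k := by
  have exists_min : ∀ l ∈ K, ∃ x, IsGlobalMin (fun x => f x l) x := fun l hl =>
    (hinf l hl).exists_isGlobalMin (hlsc l hl)
  have hvalue : UpperSemicontinuousOn (fun l => ⨅ x, f x l) K :=
    upperSemicontinuousOn_ciInf (fun l hl => (exists_min l hl).choose_spec.bddBelow_range) husc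
  obtain ⟨k, hk, hmax⟩ := hvalue.exists_isMaxOn hne hK
  obtain ⟨x, hx⟩ := exists_min k hk
  refine ⟨x, k, hk, fun z _ l hl => ?_⟩
  obtain ⟨y, hy, hyl⟩ := exists_isGlobalMin_le_iInf_of_isMaxOn_iInf hlsc hinf hconc hk hl hmax
  calc f x l = f y l := by rw [huniq k hk hx hy]
    _ ≤ ⨅ u, f u k := hyl
    _ ≤ f z k := ciInf_le hx.bddBelow_range z

end SaddlePoint

theorem exists_finite_subset_forall_exists_lt {X ι α : Type*} [TopologicalSpace X] [LinearOrder α]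
    {f : X → ι → α} {s : Set ι} {c : α} (hlsc : ∀ i ∈ s, LowerSemicontinuous (fun x => f x i))
    {i₀ : ι} (hi₀ : i₀ ∈ s) (hcpt : IsCompact {x | f x i₀ ≤ c}) (h : ∀ x, ∃ i ∈ s, c < f x i) :
    ∃ t ⊆ s, t.Finite ∧ ∀ x, ∃ i ∈ t, c < f x i := by
  obtain ⟨t, hts, htfin, hcover⟩ := hcpt.elim_finite_subcover_image (c := fun i => {x | c < f x i})
    (fun i hi => (hlsc i hi).isOpen_preimage c) fun x _ => Set.mem_iUnion₂.2 <| by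
      simpa only [Set.mem_ofPred_eq, exists_prop] using h x
  refine ⟨insert i₀ t, Set.insert_subset hi₀ hts, htfin.insert i₀, fun x => ?_⟩
  rcases le_or_gt (f x i₀) c with hx | hx
  · obtain ⟨i, hi, hxi⟩ := Set.mem_iUnion₂.1 (hcover hx)
    exact ⟨i, Set.mem_insert_of_mem i₀ hi, hxi⟩
  · exact ⟨i₀, Set.mem_insert i₀ t, hx⟩

theorem exists_real_between_of_iSup_iInf_lt_iInf_iSup {X ι : Type*} {f : X → ι → ℝ} {s : Set ι}
    (h : (⨆ i ∈ s, ⨅ x, (f x i : EReal)) < ⨅ x, ⨆ i ∈ s, (f x i : EReal)) :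
    ∃ c : ℝ, (∀ i ∈ s, ∃ x, f x i < c) ∧ ∀ x, ∃ i ∈ s, c < f x i := by
  obtain ⟨c, hlow, hhigh⟩ := EReal.lt_iff_exists_real_btwn.1 h
  refine ⟨c, fun i hi => ?_, fun x => ?_⟩
  · obtain ⟨x, hx⟩ := iInf_lt_iff.1
      ((le_iSup₂ (f := fun i (_ : i ∈ s) => ⨅ x, (f x i : EReal)) i hi).trans_lt hlow)
    exact ⟨x, EReal.coe_lt_coe_iff.1 hx⟩
  · obtain ⟨i, hi, hx⟩ := lt_biSup_iff.1 (hhigh.trans_le (iInf_le _ x))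
    exact ⟨i, hi, EReal.coe_lt_coe_iff.1 hx⟩

theorem theorem3p2_general {X : Type*} [TopologicalSpace X] [Nonempty X]
    {E : Type*} [AddCommGroup E] [Module ℝ E] [TopologicalSpace E] [IsTopologicalAddGroup E]
    [ContinuousSMul ℝ E]
    (Λ : Set E) (f : X → E → ℝ)
    (hlsc : ∀ l ∈ Λ, LowerSemicontinuous (fun x => f x l))
    (hinf : ∀ l ∈ Λ, InfCompact (fun x => f x l))
    (husc : ∀ x, UpperSemicontinuousOn (f x) Λ)
    (hconc : ∀ x, ConcaveOn ℝ Λ (f x))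
    (hlt : (⨆ l ∈ Λ, ⨅ x : X, (f x l : EReal)) < ⨅ x : X, ⨆ l ∈ Λ, (f x l : EReal)) :
    ∃ l ∈ Λ, ∃ x₁ x₂ : X, x₁ ≠ x₂ ∧
      IsGlobalMin (fun x => f x l) x₁ ∧ IsGlobalMin (fun x => f x l) x₂ := by
  by_contra hcon
  have huniq : ∀ l ∈ Λ, {x | IsGlobalMin (fun x => f x l) x}.Subsingleton :=
    fun l hl x₁ h₁ x₂ h₂ => by_contra fun hne => hcon ⟨l, hl, x₁, x₂, hne, h₁, h₂⟩
  obtain ⟨c, hlow, hhigh⟩ := exists_real_between_of_iSup_iInf_lt_iInf_iSup hlt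
  let x₀ := Classical.arbitrary X
  obtain ⟨l₀, hl₀, -⟩ := hhigh x₀
  obtain ⟨S, hSΛ, hSfin, hS⟩ :=
    exists_finite_subset_forall_exists_lt hlsc hl₀ (hinf l₀ hl₀ c) hhigh
  have hKΛ : convexHull ℝ S ⊆ Λ := convexHull_min hSΛ (hconc x₀).1
  obtain ⟨l₁, hl₁, -⟩ := hS x₀
  obtain ⟨x, k, hk, hsaddle⟩ := exists_isSaddlePointOn_of_subsingleton_isGlobalMin
    (hSfin.isCompact_convexHull ℝ) ⟨l₁, subset_convexHull ℝ S hl₁⟩ (fun l hl => hlsc l (hKΛ hl))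
    (fun l hl => hinf l (hKΛ hl)) (fun x => (husc x).mono hKΛ)
    (fun x => (hconc x).subset hKΛ (convex_convexHull ℝ S)) (fun l hl => huniq l (hKΛ hl))
  obtain ⟨z, hz⟩ := hlow k (hKΛ hk)
  obtain ⟨l, hl, hxl⟩ := hS x
  exact (hsaddle z (Set.mem_univ z) l (subset_convexHull ℝ S hl)).not_gt (hz.trans hxl)

/-- The function `f : X × Λ → ℝ` is given by a function on `X × E` of which only the values on
`X × Λ` are used. Suprema and infima are taken in the extended reals. -/
theorem theorem3p2 {X : Type*} [TopologicalSpace X] [Nonempty X]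
    {E : Type*} [AddCommGroup E] [Module ℝ E] [TopologicalSpace E] [IsTopologicalAddGroup E]
    [ContinuousSMul ℝ E] [T2Space E]
    (Λ : Set E) (hΛ : Convex ℝ Λ) (f : X → E → ℝ)
    (hlsc : ∀ l ∈ Λ, LowerSemicontinuous (fun x => f x l))
    (hinf : ∀ l ∈ Λ, InfCompact (fun x => f x l))
    (husc : ∀ x, UpperSemicontinuousOn (f x) Λ)
    (hconc : ∀ x, ConcaveOn ℝ Λ (f x))
    (hlt : (⨆ l ∈ Λ, ⨅ x : X, (f x l : EReal)) < ⨅ x : X, ⨆ l ∈ Λ, (f x l : EReal)) :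
    ∃ l ∈ Λ, ∃ x₁ x₂ : X, x₁ ≠ x₂ ∧
      IsGlobalMin (fun x => f x l) x₁ ∧ IsGlobalMin (fun x => f x l) x₂ :=
  theorem3p2_general Λ f hlsc hinf husc hconc hlt
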